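/- Let $P\subset\mathbb R^n$ be a convex body (compact, convex) of unit Lebesgue volume, with support function $\phi_P(x)=\sup_{p\in P}x\cdot p$, and let $\lambda_P=1_P\,dp$ be Lebesgue measure on $P$. Let $X\subset\mathbb R^n$ be a closed set and let $\phi_0:X\to\mathbb R$ be a weight function, i.e. $\phi_0$ is continuous and $\phi_0(x)-\phi_P(x)\to+\infty$ as $|x|\to\infty$ in $X$; extend $\phi_0$ by $+\infty$ outside $X$. Let $\mathcal P(\mathbb R^n)$ be the set of convex functions $\psi:\mathbb R^n\to\mathbb R$ such that $\psi-\phi_P$ is bounded from above. For a function $\phi$ on $X$ put $$\Pi_X(\phi)(x)=\sup\{\psi(x):\ \psi\in\mathcal P(\mathbb R^n),\ \psi\le\phi\text{ on }X\}\qquad(x\in\mathbb R^n),$$ and for a function $\phi$ on $\mathbb R^n$ with values in $[-\infty,\infty]$ put $\phi^*(p)=\sup_{x\in\mathbb R^n}(x\cdot p-\phi(x))$. For a Borel probability measure $\mu$ on $\mathbb R^n$ define the weighted energy $$E_{\phi_0}(\mu)=\sup_{u\in C_b(X)}\Big(-\int_P(\Pi_X(\phi_0+u))^*(p)\,dp-\int_X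 u\,d\mu\Big)\in(-\infty,+\infty],$$ where $C_b(X)$ is the space of bounded continuous functions $u:X\to\mathbb R$, and the Monge--Kantorovich optimal cost $$C_{\phi_0}(\mu)=\inf_\Gamma\int_{\mathbb R^n\times\mathbb R^n}\big(-x\cdot p+\phi_0(x)\big)\,d\Gamma(x,p)\in(-\infty,+\infty],$$ where $\Gamma$ ranges over all couplings of $\mu$ and $\lambda_P$, i.e. all Borel measures on $\mathbb R^n\times\mathbb R^n$ with first marginal $\mu$ and second marginal $\lambda_P$. Then, for every Borel probability measure $\mu$ on $\mathbb R^n$, $$E_{\phi_0}(\mu)=C_{\phi_0}(\mu).$$ -/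

import Mathlib

open MeasureTheory Filter
open scoped ENNReal BoundedContinuousFunction

noncomputable section

namespace WeightedEnergy

/-- The integral in `[-∞, ∞]` of an extended-real function: the integral of the positive part minus
the integral of the negative part. It is only used for functions at least one of whose two parts
has a finite integral. -/
def extIntegral {α : Type*} [MeasurableSpace α] (f : α → EReal) (μ : Measure α) : EReal :=
  ((∫⁻ a, (f a).toENNReal ∂μ : ℝ≥0∞) : EReal) - ((∫⁻ a, (-f a).toENNReal ∂μ : ℝ≥0∞) : EReal)

/-- A measure on a product is a coupling of `μ` and `ν` if its push-forwards under the two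
projections are `μ` and `ν`. -/
def IsCoupling {α β : Type*} [MeasurableSpace α] [MeasurableSpace β]
    (Γ : Measure (α × β)) (μ : Measure α) (ν : Measure β) : Prop :=
  Γ.fst = μ ∧ Γ.snd = ν

/-- The Monge-Kantorovich optimal cost of transporting `μ` to `ν` for the cost function `c`:
the infimum of the total cost over all couplings. -/
def optimalCost {α β : Type*} [MeasurableSpace α] [MeasurableSpace β]
    (c : α → β → EReal) (μ : Measure α) (ν : Measure β) : EReal :=
  ⨅ (Γ : Measure (α × β)) (_ : IsCoupling Γ μ ν), extIntegral (fun z => c z.1 z.2) Γ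

variable {n : ℕ}

/-- The support function `x ↦ sup {⟨x, p⟩ | p ∈ P}` of a convex body. -/
def supportFun (P : ConvexBody (EuclideanSpace ℝ (Fin n))) (x : EuclideanSpace ℝ (Fin n)) : ℝ :=
  ⨆ p : (P : Set (EuclideanSpace ℝ (Fin n))), inner ℝ x (p : EuclideanSpace ℝ (Fin n))

/-- The space `𝒫(ℝⁿ)` of the convex functions `φ` on `ℝⁿ` such that `φ - φ_P` is bounded from
above, where `φ_P` is the support function of `P`. -/
def convexSpace (P : ConvexBody (EuclideanSpace ℝ (Fin n))) :
    Set (EuclideanSpace ℝ (Fin n) → ℝ) :=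
  {φ | ConvexOn ℝ Set.univ φ ∧ BddAbove (Set.range fun x => φ x - supportFun P x)}

/-- A weight function on `X`: a continuous function `φ₀` on `X` such that
`φ₀ - φ_P → ∞` as `|x| → ∞` in `X`. -/
structure IsWeight (P : ConvexBody (EuclideanSpace ℝ (Fin n)))
    {X : Set (EuclideanSpace ℝ (Fin n))} (φ₀ : X → ℝ) : Prop where
  continuous : Continuous φ₀
  growth : Tendsto (fun x : X => φ₀ x - supportFun P x)
    (comap (fun x : X => ‖(x : EuclideanSpace ℝ (Fin n))‖) atTop) atTop

open Classical in
/-- The extension of a function on `X` to `ℝⁿ` by the value `∞` outside `X`. -/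
def extendTop {X : Set (EuclideanSpace ℝ (Fin n))} (φ : X → ℝ)
    (x : EuclideanSpace ℝ (Fin n)) : EReal :=
  if h : x ∈ X then ((φ ⟨x, h⟩ : ℝ) : EReal) else ⊤

/-- The projection `Π_X(φ)`: the pointwise supremum of all functions in `𝒫(ℝⁿ)`
that are at most `φ` on `X`. -/
def proj (P : ConvexBody (EuclideanSpace ℝ (Fin n))) {X : Set (EuclideanSpace ℝ (Fin n))}
    (φ : X → ℝ) (x : EuclideanSpace ℝ (Fin n)) : EReal :=
  ⨆ (ψ : EuclideanSpace ℝ (Fin n) → ℝ) (_ : ψ ∈ convexSpace P ∧ ∀ y : X, ψ y ≤ φ y),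
    ((ψ x : ℝ) : EReal)

/-- The Legendre transform `φ*(p) = sup_x (⟨x, p⟩ - φ(x))`. -/
def legendre (φ : EuclideanSpace ℝ (Fin n) → EReal) (p : EuclideanSpace ℝ (Fin n)) : EReal :=
  ⨆ x : EuclideanSpace ℝ (Fin n), ((inner ℝ x p : ℝ) : EReal) - φ x

/-- The functional `ℰ(φ) = -∫_P φ*(p) dp`. -/
def energy (P : ConvexBody (EuclideanSpace ℝ (Fin n)))
    (φ : EuclideanSpace ℝ (Fin n) → EReal) : EReal :=
  -extIntegral (legendre φ) (volume.restrict (P : Set (EuclideanSpace ℝ (Fin n))))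

/-- The weighted energy `E_{φ₀}(μ) = sup_u (ℰ(Π_X(φ₀ + u)) - ∫_X u dμ)`, where `u` ranges over
the bounded continuous functions on `X`. -/
def weightedEnergy (P : ConvexBody (EuclideanSpace ℝ (Fin n)))
    {X : Set (EuclideanSpace ℝ (Fin n))} (φ₀ : X → ℝ)
    (μ : Measure (EuclideanSpace ℝ (Fin n))) : EReal :=
  ⨆ u : X →ᵇ ℝ, energy P (proj P fun x => φ₀ x + u x) -
    ((∫ x : X, u x ∂(μ.comap (Subtype.val : X → EuclideanSpace ℝ (Fin n))) : ℝ) : EReal)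

/-- The cost function `c(x, p) = -x·p + φ₀(x)`, with `φ₀ = ∞` outside `X`. -/
def weightedCost {X : Set (EuclideanSpace ℝ (Fin n))} (φ₀ : X → ℝ)
    (x p : EuclideanSpace ℝ (Fin n)) : EReal :=
  ((-inner ℝ x p : ℝ) : EReal) + extendTop φ₀ x

/-- The cost functional `C_{φ₀}(μ)`: the optimal cost of transporting `μ` to the Lebesgue measure
on `P` for the cost function `-x·p + φ₀(x)`. -/
def weightedOptimalCost (P : ConvexBody (EuclideanSpace ℝ (Fin n)))
    {X : Set (EuclideanSpace ℝ (Fin n))} (φ₀ : X → ℝ)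
    (μ : Measure (EuclideanSpace ℝ (Fin n))) : EReal :=
  optimalCost (weightedCost φ₀) μ (volume.restrict (P : Set (EuclideanSpace ℝ (Fin n))))

end WeightedEnergy

end

open Topology CompactlySupported

/-! The identity is Kantorovich duality for the cost `-x·p + φ₀(x)` on `X × P`. For `p ∈ P` the
affine functions `y ↦ y·p - B` belong to `convexSpace P`, so the Legendre transform of `proj P φ` at
`p` equals `sup_{x ∈ X} (x·p - φ x)` (`legendre_proj_le`, `conj_le_legendre_proj`). Hence the energy
is the dual supremum of `-∫ u dμ - ∫_P v dp` over pairs with `x·p - φ₀ x ≤ u x + v p` on `X × P`.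

If `μ` is concentrated on `X`, integrating this inequality against a coupling gives energy `≤` cost.
Conversely, if the energy is a finite `e`, M. Riesz extension turns the bound on dual values into a
positive functional with the right marginals (`exists_positive_functional`). Tightness of the
marginals makes it a measure (`exists_measure_integral_eq_of_tight`), hence a coupling, and
truncating the cost bounds its total cost by `e`.

If `μ` charges the complement of `X`, both sides are `⊤`. The growth of `φ₀` enters only through the
lower bound on the cost, `IsWeight.exists_bound`. -/

namespace WeightedEnergy

/-! ### Representing tight positive functionals by measures -/

/-- A positive linear functional on bounded continuous functions which is tight along a sequence of
compactly supported cutoffs is the integral against a finite measure. -/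
theorem exists_measure_integral_eq_of_tight {α : Type*} [TopologicalSpace α] [T2Space α]
    [LocallyCompactSpace α] [MeasurableSpace α] [BorelSpace α]
    (L : (α →ᵇ ℝ) →ₗ[ℝ] ℝ) (hL : ∀ f : α →ᵇ ℝ, (∀ x, 0 ≤ f x) → 0 ≤ L f)
    (χ : ℕ → C_c(α, ℝ)) (h0 : ∀ k x, 0 ≤ χ k x) (h1 : ∀ k x, χ k x ≤ 1)
    (hlim : ∀ x, Tendsto (fun k => χ k x) atTop (𝓝 1))
    (htight : Tendsto (fun k => L (1 - (χ k).toBoundedContinuousFunction)) atTop (𝓝 0)) :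
    ∃ Γ : Measure α, IsFiniteMeasure Γ ∧ ∀ f : α →ᵇ ℝ, ∫ x, f x ∂Γ = L f := by
  have hmono : ∀ f g : α →ᵇ ℝ, (∀ x, f x ≤ g x) → L f ≤ L g := fun f g h => by
    have := hL (g - f) fun x => by simpa using h x
    rw [map_sub] at this
    linarith
  let ι : C_c(α, ℝ) →ₗ[ℝ] (α →ᵇ ℝ) :=
    { toFun := fun f => f.toBoundedContinuousFunction
      map_add' := fun f g => by ext; rfl
      map_smul' := fun r f => by ext; rfl }
  let Λ : C_c(α, ℝ) →ₚ[ℝ] ℝ := PositiveLinearMap.mk₀ (L ∘ₗ ι) fun f hf => hL _ fun x => hf x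
  have hΛ : ∀ f : C_c(α, ℝ), ∫ x, f x ∂(RealRMK.rieszMeasure Λ) =
      L f.toBoundedContinuousFunction := fun f => RealRMK.integral_rieszMeasure Λ f
  set Γ := RealRMK.rieszMeasure Λ
  have hint : ∀ f : C_c(α, ℝ), Integrable f Γ := fun f =>
    f.continuous.integrable_of_hasCompactSupport f.hasCompactSupport
  -- Fatou along the cutoffs bounds the total mass by `L 1`.
  have hfin : IsFiniteMeasure Γ := by
    refine ⟨lt_of_le_of_lt ?_ (ENNReal.ofReal_lt_top (r := L 1))⟩
    calc Γ Set.univ = ∫⁻ _, 1 ∂Γ := by simp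
      _ = ∫⁻ x, liminf (fun k => ENNReal.ofReal (χ k x)) atTop ∂Γ := by
        refine lintegral_congr fun x => ?_
        have := (ENNReal.continuous_ofReal.tendsto 1).comp (hlim x)
        simpa [Function.comp_def] using this.liminf_eq.symm
      _ ≤ liminf (fun k => ∫⁻ x, ENNReal.ofReal (χ k x) ∂Γ) atTop :=
        lintegral_liminf_le fun k => (ENNReal.continuous_ofReal.comp (χ k).continuous).measurable
      _ ≤ ENNReal.ofReal (L 1) := by
        refine liminf_le_of_frequently_le' (Frequently.of_forall fun k => ?_)
        rw [← ofReal_integral_eq_lintegral_ofReal (hint _) (Eventually.of_forall (h0 k)), hΛ]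
        exact ENNReal.ofReal_le_ofReal (hmono _ _ fun x => h1 k x)
  refine ⟨Γ, hfin, fun f => ?_⟩
  -- The integrals of `f * χ k` tend to `∫ f` by dominated convergence, and to `L f` because
  -- tightness makes the error `‖f‖ * L (1 - χ k)` vanish.
  let F : ℕ → C_c(α, ℝ) := fun k =>
    { toFun := fun x => f x * χ k x
      continuous_toFun := f.continuous.mul (χ k).continuous
      hasCompactSupport' := (χ k).hasCompactSupport.mul_left }
  have hF1 : Tendsto (fun k => ∫ x, F k x ∂Γ) atTop (𝓝 (∫ x, f x ∂Γ)) := by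
    refine tendsto_integral_of_dominated_convergence (fun _ => ‖f‖)
      (fun k => (F k).continuous.aestronglyMeasurable) (integrable_const _)
      (fun k => Eventually.of_forall fun x => ?_) (Eventually.of_forall fun x => ?_)
    · calc ‖f x * χ k x‖ = ‖f x‖ * χ k x := by
            rw [norm_mul, Real.norm_of_nonneg (h0 k x)]
        _ ≤ ‖f‖ * 1 := mul_le_mul (f.norm_coe_le_norm x) (h1 k x) (h0 k x) (norm_nonneg _)
        _ = ‖f‖ := mul_one _
    · simpa [F] using (hlim x).const_mul (f x)
  have hF2 : Tendsto (fun k => ∫ x, F k x ∂Γ) atTop (𝓝 (L f)) := by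
    rw [tendsto_iff_norm_sub_tendsto_zero]
    have hlim0 := htight.const_mul ‖f‖
    rw [mul_zero] at hlim0
    refine squeeze_zero (fun _ => norm_nonneg _) (fun k => ?_) hlim0
    have hb : ∀ x, |f x * χ k x - f x| ≤ ‖f‖ * (1 - χ k x) := fun x => by
      have : f x * χ k x - f x = -(f x * (1 - χ k x)) := by ring
      rw [this, abs_neg, abs_mul, abs_of_nonneg (sub_nonneg.2 (h1 k x))]
      exact mul_le_mul_of_nonneg_right (f.norm_coe_le_norm x) (sub_nonneg.2 (h1 k x))
    have e1 : ‖f‖ * L (1 - (χ k).toBoundedContinuousFunction) =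
        L (‖f‖ • (1 - (χ k).toBoundedContinuousFunction)) := by rw [map_smul, smul_eq_mul]
    rw [hΛ, Real.norm_eq_abs, ← map_sub, abs_le, e1, ← map_neg]
    exact ⟨hmono _ _ fun x => (abs_le.1 (hb x)).1, hmono _ _ fun x => (abs_le.1 (hb x)).2⟩
  exact tendsto_nhds_unique hF1 hF2

/-- The cutoff equal to `1` on the ball of radius `k` and to `0` outside the ball of radius
`k + 1`. -/
def ballCutoff {α : Type*} [PseudoMetricSpace α] [ProperSpace α] (x₀ : α) (k : ℕ) : C_c(α, ℝ) where
  toFun x := max 0 (min 1 (k + 1 - dist x x₀))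
  continuous_toFun := by fun_prop
  hasCompactSupport' := by
    refine HasCompactSupport.intro (isCompact_closedBall x₀ (k + 1)) fun x hx => ?_
    rw [Metric.mem_closedBall, not_le] at hx
    exact max_eq_left ((min_le_right _ _).trans (by linarith))

section ballCutoff

variable {α : Type*} [PseudoMetricSpace α] [ProperSpace α] (x₀ : α) (k : ℕ) (x : α)

theorem ballCutoff_apply : ballCutoff x₀ k x = max 0 (min 1 (k + 1 - dist x x₀)) := rfl

theorem ballCutoff_nonneg : 0 ≤ ballCutoff x₀ k x := le_max_left _ _

theorem ballCutoff_le_one : ballCutoff x₀ k x ≤ 1 := max_le zero_le_one (min_le_left _ _)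

theorem tendsto_ballCutoff : Tendsto (fun k => ballCutoff x₀ k x) atTop (𝓝 1) := by
  refine tendsto_const_nhds.congr' ?_
  filter_upwards [eventually_ge_atTop ⌈dist x x₀⌉₊] with k hk
  have : dist x x₀ ≤ k := (Nat.le_ceil _).trans (by exact_mod_cast hk)
  rw [ballCutoff_apply, min_eq_left (by linarith), max_eq_right zero_le_one]

theorem tendsto_integral_one_sub_ballCutoff [MeasurableSpace α] [OpensMeasurableSpace α]
    (μ : Measure α) [IsFiniteMeasure μ] :
    Tendsto (fun k => ∫ x, (1 - ballCutoff x₀ k x) ∂μ) atTop (𝓝 0) := by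
  have h := tendsto_integral_of_dominated_convergence (μ := μ) (f := fun _ => (0 : ℝ))
    (F := fun k x => 1 - ballCutoff x₀ k x) (fun _ => (1 : ℝ))
    (fun k => (continuous_const.sub (ballCutoff x₀ k).continuous).aestronglyMeasurable)
    (integrable_const _) (fun k => Eventually.of_forall fun x => ?_)
    (Eventually.of_forall fun x => ?_)
  · simpa using h
  · rw [Real.norm_of_nonneg (sub_nonneg.2 (ballCutoff_le_one x₀ k x))]
    linarith [ballCutoff_nonneg x₀ k x]
  · simpa using (tendsto_ballCutoff x₀ x).const_sub 1

/-- The product carries the sup distance, so its cutoff is the smaller of the two factor cutoffs.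
This reduces tightness on the product to tightness of the marginals. -/
theorem one_sub_ballCutoff_prod_le {β : Type*} [PseudoMetricSpace β] [ProperSpace β]
    (z₀ z : α × β) (k : ℕ) :
    1 - ballCutoff z₀ k z ≤ (1 - ballCutoff z₀.1 k z.1) + (1 - ballCutoff z₀.2 k z.2) := by
  simp only [ballCutoff_apply, Prod.dist_eq]
  rcases le_total (dist z.1 z₀.1) (dist z.2 z₀.2) with h | h
  · rw [max_eq_right h]
    linarith [ballCutoff_le_one z₀.1 k z.1, ballCutoff_apply z₀.1 k z.1]
  · rw [max_eq_left h]
    linarith [ballCutoff_le_one z₀.2 k z.2, ballCutoff_apply z₀.2 k z.2]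

end ballCutoff

/-! ### Kantorovich duality -/

/-- Kantorovich duality, functional form: if `e` bounds all dual values for the cost `c` on `S`,
then some positive functional with the prescribed marginals is at most `e` on the functions
below `c`. -/
theorem exists_positive_functional {α β : Type*} [TopologicalSpace α] [TopologicalSpace β]
    [MeasurableSpace α] [OpensMeasurableSpace α] [MeasurableSpace β] [OpensMeasurableSpace β]
    (μ : Measure α) (ν : Measure β) [IsProbabilityMeasure μ] [IsProbabilityMeasure ν]
    (S : Set (α × β)) (c : α × β → ℝ) (e : ℝ)
    (h0 : ∀ (u : α →ᵇ ℝ) (v : β →ᵇ ℝ), (∀ z ∈ S, 0 ≤ u z.1 + v z.2) →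
      0 ≤ ∫ x, u x ∂μ + ∫ y, v y ∂ν)
    (h1 : ∀ (u : α →ᵇ ℝ) (v : β →ᵇ ℝ), (∀ z ∈ S, 0 ≤ u z.1 + v z.2 + c z) →
      0 ≤ ∫ x, u x ∂μ + ∫ y, v y ∂ν + e) :
    ∃ L : (α × β →ᵇ ℝ) →ₗ[ℝ] ℝ,
      (∀ f : α × β →ᵇ ℝ, (∀ z ∈ S, 0 ≤ f z) → 0 ≤ L f) ∧
      (∀ (f : α × β →ᵇ ℝ) (u : α →ᵇ ℝ) (v : β →ᵇ ℝ), (∀ z, f z = u z.1 + v z.2) →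
        L f = ∫ x, u x ∂μ + ∫ y, v y ∂ν) ∧
      ∀ f : α × β →ᵇ ℝ, (∀ z ∈ S, f z ≤ c z) → L f ≤ e := by
  -- The cost `c` may be unbounded, so it is adjoined through a separate real coordinate, its
  -- coefficient.
  let V := (α →ᵇ ℝ) × (β →ᵇ ℝ) × ℝ × (α × β →ᵇ ℝ)
  let s : PointedCone ℝ V :=
    { carrier := {w | 0 ≤ w.2.2.1 ∧ ∀ z ∈ S, 0 ≤ w.1 z.1 + w.2.1 z.2 + w.2.2.1 * c z + w.2.2.2 z}
      add_mem' := fun {a b} ha hb => ⟨add_nonneg ha.1 hb.1, fun z hz => by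
        have := add_nonneg (ha.2 z hz) (hb.2 z hz)
        have e1 : (a + b).1 z.1 = a.1 z.1 + b.1 z.1 := rfl
        have e2 : (a + b).2.1 z.2 = a.2.1 z.2 + b.2.1 z.2 := rfl
        have e3 : (a + b).2.2.1 = a.2.2.1 + b.2.2.1 := rfl
        have e4 : (a + b).2.2.2 z = a.2.2.2 z + b.2.2.2 z := rfl
        rw [e1, e2, e3, e4]
        linarith⟩
      zero_mem' := ⟨le_rfl, fun z _ => by simp⟩
      smul_mem' := fun r a ha => ⟨mul_nonneg r.2 ha.1, fun z hz => by
        have := mul_nonneg r.2 (ha.2 z hz)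
        have e1 : (r • a).1 z.1 = (r : ℝ) * a.1 z.1 := rfl
        have e2 : (r • a).2.1 z.2 = (r : ℝ) * a.2.1 z.2 := rfl
        have e3 : (r • a).2.2.1 = (r : ℝ) * a.2.2.1 := rfl
        have e4 : (r • a).2.2.2 z = (r : ℝ) * a.2.2.2 z := rfl
        rw [e1, e2, e3, e4]
        linarith⟩ }
  let ℓ : V →ₗ[ℝ] ℝ :=
    { toFun := fun w => ∫ x, w.1 x ∂μ + ∫ y, w.2.1 y ∂ν + w.2.2.1 * e
      map_add' := fun a b => by
        have e1 : ∫ x, (a + b).1 x ∂μ = ∫ x, a.1 x ∂μ + ∫ x, b.1 x ∂μ :=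
          integral_add (a.1.integrable μ) (b.1.integrable μ)
        have e2 : ∫ y, (a + b).2.1 y ∂ν = ∫ y, a.2.1 y ∂ν + ∫ y, b.2.1 y ∂ν :=
          integral_add (a.2.1.integrable ν) (b.2.1.integrable ν)
        have e3 : (a + b).2.2.1 = a.2.2.1 + b.2.2.1 := rfl
        rw [e1, e2, e3]
        ring
      map_smul' := fun r a => by
        have e1 : ∫ x, (r • a).1 x ∂μ = r * ∫ x, a.1 x ∂μ := integral_const_mul r _
        have e2 : ∫ y, (r • a).2.1 y ∂ν = r * ∫ y, a.2.1 y ∂ν := integral_const_mul r _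
        have e3 : (r • a).2.2.1 = r * a.2.2.1 := rfl
        rw [e1, e2, e3]
        simp only [RingHom.id_apply, smul_eq_mul]
        ring }
  let π : V →ₗ[ℝ] (α × β →ᵇ ℝ) := LinearMap.snd ℝ _ _ ∘ₗ LinearMap.snd ℝ _ _ ∘ₗ LinearMap.snd ℝ _ _
  let f₀ : V →ₗ.[ℝ] ℝ := ⟨LinearMap.ker π, ℓ ∘ₗ (LinearMap.ker π).subtype⟩
  obtain ⟨g, hg, hgs⟩ := riesz_extension s f₀ (by
      rintro ⟨⟨u, v, t, f⟩, hf⟩ ⟨ht, hS⟩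
      obtain rfl : f = 0 := hf
      change 0 ≤ ∫ x, u x ∂μ + ∫ y, v y ∂ν + t * e
      simp only [BoundedContinuousFunction.coe_zero, Pi.zero_apply, add_zero] at hS ht
      -- A zero coefficient of `c` is covered by `h0`; a positive one is scaled to `1` for `h1`.
      rcases ht.eq_or_lt with rfl | ht
      · simpa using h0 u v (by simpa using hS)
      · have := h1 (t⁻¹ • u) (t⁻¹ • v) fun z hz => by
          have := mul_nonneg (inv_nonneg.2 ht.le) (hS z hz)
          have e1 : (t⁻¹ • u) z.1 = t⁻¹ * u z.1 := rfl
          have e2 : (t⁻¹ • v) z.2 = t⁻¹ * v z.2 := rfl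
          rw [e1, e2]
          rwa [mul_add, mul_add, ← mul_assoc, inv_mul_cancel₀ ht.ne', one_mul] at this
        have e1 : ∫ x, (t⁻¹ • u) x ∂μ = t⁻¹ * ∫ x, u x ∂μ := integral_const_mul _ _
        have e2 : ∫ y, (t⁻¹ • v) y ∂ν = t⁻¹ * ∫ y, v y ∂ν := integral_const_mul _ _
        rw [e1, e2] at this
        have := mul_nonneg ht.le this
        rwa [mul_add, mul_add, ← mul_assoc, ← mul_assoc, mul_inv_cancel₀ ht.ne', one_mul,
          one_mul] at this) (by
      rintro ⟨u, v, t, f⟩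
      -- The coefficient `-t` cancels the possibly unbounded `c`; the constant then dominates the
      -- bounded remainder.
      refine ⟨⟨(BoundedContinuousFunction.const _ (‖u‖ + ‖v‖ + ‖f‖), 0, -t, 0), rfl⟩, ?_, ?_⟩
      · exact (neg_add_cancel t).ge
      · intro z _
        have hu := neg_le_of_abs_le (u.norm_coe_le_norm z.1)
        have hv := neg_le_of_abs_le (v.norm_coe_le_norm z.2)
        have hf := neg_le_of_abs_le (f.norm_coe_le_norm z)
        change 0 ≤ (‖u‖ + ‖v‖ + ‖f‖ + u z.1) + (0 + v z.2) + (-t + t) * c z + (0 + f z)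
        linarith)
  have hmem : ∀ (u : α →ᵇ ℝ) (v : β →ᵇ ℝ) (t : ℝ) (f : α × β →ᵇ ℝ), 0 ≤ t →
      (∀ z ∈ S, 0 ≤ u z.1 + v z.2 + t * c z + f z) → 0 ≤ g (u, v, t, f) :=
    fun u v t f ht h => hgs _ ⟨ht, h⟩
  have hker : ∀ (u : α →ᵇ ℝ) (v : β →ᵇ ℝ) (t : ℝ),
      g (u, v, t, 0) = ∫ x, u x ∂μ + ∫ y, v y ∂ν + t * e := fun u v t => hg ⟨(u, v, t, 0), rfl⟩
  let j : (α × β →ᵇ ℝ) →ₗ[ℝ] V :=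
    LinearMap.inr ℝ _ _ ∘ₗ LinearMap.inr ℝ _ _ ∘ₗ LinearMap.inr ℝ _ _
  have hsum : ∀ (u : α →ᵇ ℝ) (v : β →ᵇ ℝ) (t : ℝ) (f : α × β →ᵇ ℝ),
      g (u, v, t, f) = ∫ x, u x ∂μ + ∫ y, v y ∂ν + t * e + (g ∘ₗ j) f := fun u v t f => by
    rw [← hker u v t, LinearMap.comp_apply, ← map_add]
    congr 1
    simp [j, V]
  refine ⟨g ∘ₗ j, fun f hf => hmem 0 0 0 f le_rfl fun z hz => ?_, fun f u v huv => ?_,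
    fun f hf => ?_⟩
  · simpa using hf z hz
  · have p1 := hmem u v 0 (-f) le_rfl fun z _ => by simp [huv]
    have p2 := hmem (-u) (-v) 0 f le_rfl fun z _ => by simp [huv]; linarith
    rw [hsum, map_neg] at p1
    rw [hsum] at p2
    have e1 : ∫ x, (-u) x ∂μ = -∫ x, u x ∂μ := integral_neg _
    have e2 : ∫ y, (-v) y ∂ν = -∫ y, v y ∂ν := integral_neg _
    rw [e1, e2] at p2
    linarith
  · have p := hmem 0 0 1 (-f) zero_le_one fun z hz => by simpa using hf z hz
    rw [hsum, map_neg] at p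
    simp only [BoundedContinuousFunction.coe_zero, Pi.zero_apply, integral_zero] at p
    linarith

/-- Kantorovich duality: if `e` bounds all dual values for the cost `c` on `S`, then some coupling
integrates every bounded continuous function below `c` on `S` to at most `e`. -/
theorem exists_coupling_integral_le {α β : Type*} [MetricSpace α] [ProperSpace α]
    [MetricSpace β] [ProperSpace β] [MeasurableSpace α] [BorelSpace α]
    [MeasurableSpace β] [BorelSpace β]
    (μ : Measure α) (ν : Measure β) [IsProbabilityMeasure μ] [IsProbabilityMeasure ν]
    (S : Set (α × β)) (c : α × β → ℝ) (e : ℝ)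
    (h0 : ∀ (u : α →ᵇ ℝ) (v : β →ᵇ ℝ), (∀ z ∈ S, 0 ≤ u z.1 + v z.2) →
      0 ≤ ∫ x, u x ∂μ + ∫ y, v y ∂ν)
    (h1 : ∀ (u : α →ᵇ ℝ) (v : β →ᵇ ℝ), (∀ z ∈ S, 0 ≤ u z.1 + v z.2 + c z) →
      0 ≤ ∫ x, u x ∂μ + ∫ y, v y ∂ν + e) :
    ∃ Γ : Measure (α × β), IsFiniteMeasure Γ ∧ IsCoupling Γ μ ν ∧
      ∀ f : α × β →ᵇ ℝ, (∀ z ∈ S, f z ≤ c z) → ∫ z, f z ∂Γ ≤ e := by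
  obtain ⟨L, hpos, hmarg, hle⟩ := exists_positive_functional μ ν S c e h0 h1
  obtain ⟨x₀⟩ : Nonempty α := nonempty_of_isProbabilityMeasure μ
  obtain ⟨y₀⟩ : Nonempty β := nonempty_of_isProbabilityMeasure ν
  obtain ⟨Γ, hΓ, hL⟩ := exists_measure_integral_eq_of_tight L (fun f hf => hpos f fun z _ => hf z)
    (ballCutoff (x₀, y₀)) (ballCutoff_nonneg _) (ballCutoff_le_one _) (tendsto_ballCutoff _) (by
      have hlim := (tendsto_integral_one_sub_ballCutoff x₀ μ).add
        (tendsto_integral_one_sub_ballCutoff y₀ ν)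
      rw [add_zero] at hlim
      refine squeeze_zero (fun k => hpos _ fun z _ => sub_nonneg.2 (ballCutoff_le_one _ k z))
        (fun k => ?_) hlim
      let u : α →ᵇ ℝ := 1 - (ballCutoff x₀ k).toBoundedContinuousFunction
      let v : β →ᵇ ℝ := 1 - (ballCutoff y₀ k).toBoundedContinuousFunction
      let f : α × β →ᵇ ℝ := u.compContinuous ⟨Prod.fst, continuous_fst⟩ +
        v.compContinuous ⟨Prod.snd, continuous_snd⟩
      have hf := hmarg f u v fun z => rfl
      have := hpos (f - (1 - (ballCutoff (x₀, y₀) k).toBoundedContinuousFunction)) fun z _ =>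
        sub_nonneg.2 (one_sub_ballCutoff_prod_le (x₀, y₀) z k)
      rw [map_sub, hf] at this
      exact sub_nonneg.1 this)
  refine ⟨Γ, hΓ, ⟨?_, ?_⟩, fun f hf => (hL f).trans_le (hle f hf)⟩
  · refine ext_of_forall_integral_eq_of_IsFiniteMeasure fun u => ?_
    rw [Measure.fst, integral_map measurable_fst.aemeasurable u.continuous.aestronglyMeasurable]
    refine (hL (u.compContinuous ⟨Prod.fst, continuous_fst⟩)).trans ?_
    rw [hmarg _ u 0 fun z => by simp]
    simp
  · refine ext_of_forall_integral_eq_of_IsFiniteMeasure fun v => ?_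
    rw [Measure.snd, integral_map measurable_snd.aemeasurable v.continuous.aestronglyMeasurable]
    refine (hL (v.compContinuous ⟨Prod.snd, continuous_snd⟩)).trans ?_
    rw [hmarg _ 0 v fun z => by simp]
    simp

/-! ### Extended integrals, truncation and couplings -/

theorem extIntegral_mono_ae {α : Type*} [MeasurableSpace α] {μ : Measure α} {f g : α → EReal}
    (h : f ≤ᵐ[μ] g) : extIntegral f μ ≤ extIntegral g μ := by
  refine EReal.sub_le_sub ?_ ?_
  · exact EReal.coe_ennreal_le_coe_ennreal_iff.2
      (lintegral_mono_ae (h.mono fun _ ha => EReal.toENNReal_le_toENNReal ha))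
  · exact EReal.coe_ennreal_le_coe_ennreal_iff.2
      (lintegral_mono_ae (h.mono fun _ ha =>
        EReal.toENNReal_le_toENNReal (EReal.neg_le_neg_iff.2 ha)))

theorem extIntegral_coe {α : Type*} [MeasurableSpace α] {μ : Measure α} {f : α → ℝ}
    (hf : Integrable f μ) : extIntegral (fun a => (f a : EReal)) μ = ((∫ a, f a ∂μ : ℝ) : EReal) := by
  have h1 : ∫⁻ a, ENNReal.ofReal (f a) ∂μ ≠ ⊤ := hf.lintegral_lt_top.ne
  have h2 : ∫⁻ a, ENNReal.ofReal (-f a) ∂μ ≠ ⊤ := hf.neg.lintegral_lt_top.ne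
  rw [integral_eq_lintegral_pos_part_sub_lintegral_neg_part hf, EReal.coe_sub,
    ← EReal.toReal_coe_ennreal, ← EReal.toReal_coe_ennreal,
    EReal.coe_toReal (by simpa using h1) (by simp), EReal.coe_toReal (by simpa using h2) (by simp)]
  rfl

theorem integral_le_extIntegral {α : Type*} [MeasurableSpace α] {μ : Measure α} {f : α → ℝ}
    {g : α → EReal} (hf : Integrable f μ) (h : ∀ᵐ a ∂μ, (f a : EReal) ≤ g a) :
    ((∫ a, f a ∂μ : ℝ) : EReal) ≤ extIntegral g μ :=
  (extIntegral_coe hf).symm.trans_le (extIntegral_mono_ae h)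

theorem extIntegral_le_integral {α : Type*} [MeasurableSpace α] {μ : Measure α} {f : α → ℝ}
    {g : α → EReal} (hf : Integrable f μ) (h : ∀ᵐ a ∂μ, g a ≤ (f a : EReal)) :
    extIntegral g μ ≤ ((∫ a, f a ∂μ : ℝ) : EReal) :=
  (extIntegral_mono_ae h).trans_eq (extIntegral_coe hf)

/-- A function bounded from below whose truncations have integrals at most `e` has an integral at
most `e`. -/
theorem integrable_and_integral_le_of_truncation {α : Type*} [MeasurableSpace α] {μ : Measure α}
    [IsProbabilityMeasure μ] {f : α → ℝ} (hf : Measurable f) {C e : ℝ} (hC : ∀ᵐ a ∂μ, -C ≤ f a)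
    (h : ∀ k : ℕ, ∫ a, max (-C) (min (f a) k) ∂μ ≤ e) : Integrable f μ ∧ ∫ a, f a ∂μ ≤ e := by
  let t : ℕ → α → ℝ := fun k a => max (-C) (min (f a) k)
  have htm : ∀ k, Measurable (t k) := fun k => measurable_const.max (hf.min measurable_const)
  have hti : ∀ k, Integrable (t k) μ := fun k =>
    Integrable.of_bound (htm k).aestronglyMeasurable (|C| + k) <| Eventually.of_forall fun a => by
      rw [Real.norm_eq_abs, abs_le]
      have h1 : -C ≤ t k a := le_max_left _ _
      have h2 : t k a ≤ |C| + k := max_le (by linarith [neg_abs_le C, Nat.cast_nonneg (α := ℝ) k])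
        ((min_le_right _ _).trans (by linarith [abs_nonneg C]))
      exact ⟨by linarith [le_abs_self C, Nat.cast_nonneg (α := ℝ) k], h2⟩
  -- Gives `0 ≤ e + C`, needed to remove `ENNReal.ofReal` from the final inequality.
  have hle : -C ≤ e := by
    refine le_trans ?_ (h 0)
    have := integral_mono (μ := μ) (integrable_const (-C)) (hti 0) fun a => le_max_left _ _
    rwa [integral_const, probReal_univ, one_smul] at this
  have hlint : ∫⁻ a, ENNReal.ofReal (f a + C) ∂μ ≤ ENNReal.ofReal (e + C) := by
    calc ∫⁻ a, ENNReal.ofReal (f a + C) ∂μ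
        = ∫⁻ a, liminf (fun k => ENNReal.ofReal (t k a + C)) atTop ∂μ := by
          refine lintegral_congr_ae (hC.mono fun a ha => ?_)
          have hev : (fun _ : ℕ => ENNReal.ofReal (f a + C)) =ᶠ[atTop]
              fun k => ENNReal.ofReal (t k a + C) := by
            filter_upwards [eventually_ge_atTop ⌈f a⌉₊] with k hk
            have : f a ≤ k := (Nat.le_ceil _).trans (by exact_mod_cast hk)
            simp only [t]
            rw [min_eq_left this, max_eq_right ha]
          exact ((tendsto_const_nhds.congr' hev).liminf_eq).symm
      _ ≤ liminf (fun k => ∫⁻ a, ENNReal.ofReal (t k a + C) ∂μ) atTop :=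
          lintegral_liminf_le fun k => ((htm k).add_const C).ennreal_ofReal
      _ ≤ ENNReal.ofReal (e + C) := by
          refine liminf_le_of_frequently_le' (Frequently.of_forall fun k => ?_)
          rw [← ofReal_integral_eq_lintegral_ofReal (f := fun a => t k a + C)
            ((hti k).add (integrable_const C))
            (Eventually.of_forall fun a => ?_)]
          · refine ENNReal.ofReal_le_ofReal ?_
            rw [integral_add (hti k) (integrable_const C)]
            simpa using h k
          · have : -C ≤ t k a := le_max_left _ _
            change 0 ≤ t k a + C
            linarith
  have hnn : 0 ≤ᵐ[μ] fun a => f a + C := hC.mono fun a ha => by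
    change 0 ≤ f a + C
    linarith
  have hfC : Integrable (fun a => f a + C) μ :=
    (lintegral_ofReal_ne_top_iff_integrable (hf.add_const C).aestronglyMeasurable hnn).1
      (ne_top_of_le_ne_top ENNReal.ofReal_ne_top hlint)
  have hfi : Integrable f μ :=
    (hfC.sub (integrable_const C)).congr (Eventually.of_forall fun a => add_sub_cancel_right _ _)
  refine ⟨hfi, ?_⟩
  rw [← ofReal_integral_eq_lintegral_ofReal hfC hnn, integral_add hfi (integrable_const C),
    ENNReal.ofReal_le_ofReal_iff (by linarith)] at hlint
  simpa using hlint

section coupling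

variable {α β : Type*} [MeasurableSpace α] [MeasurableSpace β] {Γ : Measure (α × β)}
  {μ : Measure α} {ν : Measure β}

theorem IsCoupling.isProbabilityMeasure (h : IsCoupling Γ μ ν) [IsProbabilityMeasure μ] :
    IsProbabilityMeasure Γ := by
  refine ⟨?_⟩
  rw [← Measure.fst_univ, h.1, measure_univ]

theorem IsCoupling.ae_fst (h : IsCoupling Γ μ ν) {p : α → Prop} (hp : ∀ᵐ x ∂μ, p x) :
    ∀ᵐ z ∂Γ, p z.1 := by
  rw [← h.1] at hp
  exact ae_of_ae_map measurable_fst.aemeasurable hp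

theorem IsCoupling.ae_snd (h : IsCoupling Γ μ ν) {p : β → Prop} (hp : ∀ᵐ y ∂ν, p y) :
    ∀ᵐ z ∂Γ, p z.2 := by
  rw [← h.2] at hp
  exact ae_of_ae_map measurable_snd.aemeasurable hp

theorem IsCoupling.integral_fst (h : IsCoupling Γ μ ν) {f : α → ℝ} (hf : Integrable f μ) :
    Integrable (fun z => f z.1) Γ ∧ ∫ z, f z.1 ∂Γ = ∫ x, f x ∂μ := by
  obtain ⟨rfl, -⟩ := h
  exact ⟨hf.comp_measurable measurable_fst,
    (integral_map measurable_fst.aemeasurable hf.aestronglyMeasurable).symm⟩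

theorem IsCoupling.integral_snd (h : IsCoupling Γ μ ν) {f : β → ℝ} (hf : Integrable f ν) :
    Integrable (fun z => f z.2) Γ ∧ ∫ z, f z.2 ∂Γ = ∫ y, f y ∂ν := by
  obtain ⟨-, rfl⟩ := h
  exact ⟨hf.comp_measurable measurable_snd,
    (integral_map measurable_snd.aemeasurable hf.aestronglyMeasurable).symm⟩

end coupling

/-! ### Weights, Legendre transforms and the projection -/

variable {n : ℕ} {P : ConvexBody (EuclideanSpace ℝ (Fin n))}
  {X : Set (EuclideanSpace ℝ (Fin n))}

theorem inner_le_supportFun (x : EuclideanSpace ℝ (Fin n)) {p : EuclideanSpace ℝ (Fin n)}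
    (hp : p ∈ P) : inner ℝ x p ≤ supportFun P x := by
  obtain ⟨M, hM⟩ := P.isCompact.isBounded.exists_norm_le
  refine le_ciSup (f := fun q : (P : Set (EuclideanSpace ℝ (Fin n))) =>
    inner ℝ x (q : EuclideanSpace ℝ (Fin n))) ⟨‖x‖ * M, ?_⟩ ⟨p, hp⟩
  rintro _ ⟨q, rfl⟩
  exact (real_inner_le_norm _ _).trans (mul_le_mul_of_nonneg_left (hM q q.2) (norm_nonneg _))

/-- The cost `-x·p + φ₀(x)` of a weight is bounded from below on `X × P`. -/
theorem IsWeight.exists_bound {φ₀ : X → ℝ} (hφ₀ : IsWeight P φ₀) (hX : IsClosed X) :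
    ∃ C : ℝ, ∀ x : X, ∀ p ∈ P, inner ℝ (x : EuclideanSpace ℝ (Fin n)) p - φ₀ x ≤ C := by
  obtain ⟨M, hM⟩ := P.isCompact.isBounded.exists_norm_le
  have hev := hφ₀.growth.eventually_ge_atTop 0
  rw [eventually_comap] at hev
  obtain ⟨R, hR⟩ := eventually_atTop.1 hev
  have hK : IsCompact (Subtype.val ⁻¹' Metric.closedBall 0 R : Set X) :=
    hX.isClosedEmbedding_subtypeVal.isCompact_preimage (isCompact_closedBall _ _)
  obtain ⟨B, hB⟩ := hK.bddAbove_image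
    (f := fun x : X => ‖(x : EuclideanSpace ℝ (Fin n))‖ * M - φ₀ x)
    (((continuous_subtype_val.norm).mul_const M).sub hφ₀.continuous).continuousOn
  refine ⟨max 0 B, fun x p hp => ?_⟩
  -- Far out, `φ₀` dominates the support function, hence `x·p`; the rest of `X` is compact.
  rcases le_total R ‖(x : EuclideanSpace ℝ (Fin n))‖ with h | h
  · refine le_max_of_le_left ?_
    have := hR _ h x rfl
    linarith [inner_le_supportFun (P := P) (x : EuclideanSpace ℝ (Fin n)) hp]
  · refine le_max_of_le_right (le_trans ?_ (hB ⟨x, by simpa using h, rfl⟩))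
    have := (real_inner_le_norm (x : EuclideanSpace ℝ (Fin n)) p).trans
      (mul_le_mul_of_nonneg_left (hM p hp) (norm_nonneg _))
    linarith

/-- The Legendre transform of the extension of `φ` by `∞` outside `X`. -/
noncomputable def conj (φ : X → ℝ) (p : EuclideanSpace ℝ (Fin n)) : EReal :=
  ⨆ x : X, ((inner ℝ (x : EuclideanSpace ℝ (Fin n)) p - φ x : ℝ) : EReal)

theorem measurable_conj (φ : X → ℝ) : Measurable (conj φ) := by
  refine LowerSemicontinuous.measurable (lowerSemicontinuous_iSup fun x => ?_)
  exact (continuous_coe_real_ereal.comp (by fun_prop)).lowerSemicontinuous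

/-- The affine function `y ↦ y·p - B` competes in the supremum defining `proj P φ`: it lies below
`φ` on `X` by `hB`, and in `convexSpace P` because `p ∈ P`. -/
theorem legendre_proj_le {φ : X → ℝ} {p : EuclideanSpace ℝ (Fin n)} (hp : p ∈ P) {B : ℝ}
    (hB : ∀ x : X, inner ℝ (x : EuclideanSpace ℝ (Fin n)) p - φ x ≤ B) :
    legendre (proj P φ) p ≤ B := by
  refine iSup_le fun y => ?_
  have hψ : ((inner ℝ y p - B : ℝ) : EReal) ≤ proj P φ y := by
    refine le_iSup₂_of_le (fun y => inner ℝ y p - B) ⟨⟨?_, -B, ?_⟩, fun x => ?_⟩ le_rfl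
    · refine ⟨convex_univ, fun x _ z _ a b _ _ hab => ?_⟩
      simp only [inner_add_left, real_inner_smul_left, smul_eq_mul]
      obtain rfl : b = 1 - a := by linarith
      linarith
    · rintro _ ⟨x, rfl⟩
      linarith [inner_le_supportFun (P := P) x hp]
    · linarith [hB x]
  calc ((inner ℝ y p : ℝ) : EReal) - proj P φ y
      ≤ ((inner ℝ y p : ℝ) : EReal) - ((inner ℝ y p - B : ℝ) : EReal) :=
        EReal.sub_le_sub le_rfl hψ
    _ = B := by rw [← EReal.coe_sub, sub_sub_cancel]

theorem conj_le_legendre_proj (φ : X → ℝ) (p : EuclideanSpace ℝ (Fin n)) :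
    conj φ p ≤ legendre (proj P φ) p := by
  refine iSup_le fun x => le_iSup_of_le (x : EuclideanSpace ℝ (Fin n)) ?_
  rw [EReal.coe_sub]
  exact EReal.sub_le_sub le_rfl (iSup₂_le fun ψ hψ => EReal.coe_le_coe_iff.2 (hψ.2 x))

theorem energy_proj_ge {φ : X → ℝ} {v : EuclideanSpace ℝ (Fin n) → ℝ}
    (hv : IntegrableOn v P)
    (h : ∀ x : X, ∀ p ∈ P, inner ℝ (x : EuclideanSpace ℝ (Fin n)) p - φ x ≤ v p) :
    ((-∫ p in P, v p : ℝ) : EReal) ≤ energy P (proj P φ) := by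
  rw [EReal.coe_neg, energy, EReal.neg_le_neg_iff]
  refine extIntegral_le_integral hv ?_
  filter_upwards [ae_restrict_mem P.isCompact.isClosed.measurableSet] with p hp
  exact legendre_proj_le hp fun x => h x p hp

theorem conj_bounds [Nonempty X] {φ : X → ℝ} {C : ℝ}
    (hC : ∀ x : X, ∀ p ∈ P, inner ℝ (x : EuclideanSpace ℝ (Fin n)) p - φ x ≤ C) :
    ∃ D : ℝ, ∀ p ∈ P, (D : EReal) ≤ conj φ p ∧ conj φ p ≤ C := by
  obtain ⟨M, hM⟩ := P.isCompact.isBounded.exists_norm_le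
  obtain ⟨x⟩ := ‹Nonempty X›
  refine ⟨-(‖(x : EuclideanSpace ℝ (Fin n))‖ * M) - φ x, fun p hp => ⟨?_, ?_⟩⟩
  · refine le_iSup_of_le x (EReal.coe_le_coe_iff.2 ?_)
    have := (abs_le.1 (abs_real_inner_le_norm (x : EuclideanSpace ℝ (Fin n)) p)).1
    have := mul_le_mul_of_nonneg_left (hM p hp) (norm_nonneg (x : EuclideanSpace ℝ (Fin n)))
    linarith
  · exact iSup_le fun x => EReal.coe_le_coe_iff.2 (hC x p hp)

/-- On `P` the Legendre transform of `proj P φ` is a real integrable function, namely the conjugate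
of `φ`. -/
theorem exists_integrable_conj [Nonempty X] {φ : X → ℝ} {C : ℝ}
    (hC : ∀ x : X, ∀ p ∈ P, inner ℝ (x : EuclideanSpace ℝ (Fin n)) p - φ x ≤ C) :
    ∃ g : EuclideanSpace ℝ (Fin n) → ℝ, IntegrableOn g P ∧
      (∀ x : X, ∀ p ∈ P, inner ℝ (x : EuclideanSpace ℝ (Fin n)) p - φ x ≤ g p) ∧
      energy P (proj P φ) ≤ ((-∫ p in P, g p : ℝ) : EReal) := by
  obtain ⟨D, hD⟩ := conj_bounds hC
  have hcoe : ∀ p ∈ P, ((conj φ p).toReal : EReal) = conj φ p := fun p hp =>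
    EReal.coe_toReal (ne_top_of_le_ne_top (EReal.coe_ne_top C) (hD p hp).2)
      (ne_bot_of_le_ne_bot (EReal.coe_ne_bot D) (hD p hp).1)
  have hmem := ae_restrict_mem (μ := volume) P.isCompact.isClosed.measurableSet
  have hg : IntegrableOn (fun p => (conj φ p).toReal) P := by
    refine ⟨(measurable_conj φ).ereal_toReal.aestronglyMeasurable, ?_⟩
    have : IsFiniteMeasure (volume.restrict (P : Set (EuclideanSpace ℝ (Fin n)))) :=
      ⟨by simpa using P.isCompact.measure_lt_top⟩
    refine HasFiniteIntegral.of_bounded (C := max |D| |C|) (hmem.mono fun p hp => ?_)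
    have h := hD p hp
    rw [← hcoe p hp, EReal.coe_le_coe_iff, EReal.coe_le_coe_iff] at h
    exact abs_le_max_abs_abs h.1 h.2
  refine ⟨fun p => (conj φ p).toReal, hg, fun x p hp => ?_, ?_⟩
  · rw [← EReal.coe_le_coe_iff, hcoe p hp]
    exact le_iSup (fun x : X => ((inner ℝ (x : EuclideanSpace ℝ (Fin n)) p - φ x : ℝ) : EReal)) x
  · rw [EReal.coe_neg, energy, EReal.neg_le_neg_iff]
    refine integral_le_extIntegral hg (hmem.mono fun p hp => ?_)
    rw [hcoe p hp]
    exact conj_le_legendre_proj φ p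

theorem weightedCost_of_mem (φ₀ : X → ℝ) {x : EuclideanSpace ℝ (Fin n)} (hx : x ∈ X)
    (p : EuclideanSpace ℝ (Fin n)) :
    weightedCost φ₀ x p = ((-inner ℝ x p + φ₀ ⟨x, hx⟩ : ℝ) : EReal) := by
  rw [weightedCost, extendTop, dif_pos hx, EReal.coe_add]

theorem weightedCost_of_notMem (φ₀ : X → ℝ) {x : EuclideanSpace ℝ (Fin n)} (hx : x ∉ X)
    (p : EuclideanSpace ℝ (Fin n)) : weightedCost φ₀ x p = ⊤ := by
  rw [weightedCost, extendTop, dif_neg hx, EReal.coe_add_top]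

theorem integral_comap_restrict (hX : IsClosed X) {μ : Measure (EuclideanSpace ℝ (Fin n))}
    (hμ : ∀ᵐ x ∂μ, x ∈ X) (u : EuclideanSpace ℝ (Fin n) → ℝ) :
    ∫ x : X, u x ∂(μ.comap (Subtype.val : X → EuclideanSpace ℝ (Fin n))) = ∫ x, u x ∂μ := by
  rw [integral_subtype_comap hX.measurableSet, Measure.restrict_eq_self_of_ae_mem hμ]

/-! ### The two inequalities, and measures charging the complement of `X` -/

section duality

variable {φ₀ : X → ℝ} {μ : Measure (EuclideanSpace ℝ (Fin n))}

theorem neg_integral_le_weightedEnergy (hX : IsClosed X) (hμ : ∀ᵐ x ∂μ, x ∈ X)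
    (u : EuclideanSpace ℝ (Fin n) →ᵇ ℝ) {v : EuclideanSpace ℝ (Fin n) → ℝ} (hv : IntegrableOn v P)
    (h : ∀ x : X, ∀ p ∈ P, inner ℝ (x : EuclideanSpace ℝ (Fin n)) p - φ₀ x ≤ u x + v p) :
    ((-∫ x, u x ∂μ - ∫ p in P, v p : ℝ) : EReal) ≤ weightedEnergy P φ₀ μ := by
  refine le_iSup_of_le (u.domRestrict X) ?_
  have e1 : ∫ x : X, u.domRestrict X x ∂(μ.comap (Subtype.val : X → EuclideanSpace ℝ (Fin n))) =
      ∫ x, u x ∂μ := integral_comap_restrict hX hμ u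
  rw [e1, sub_eq_add_neg, add_comm, ← sub_eq_add_neg, EReal.coe_sub]
  refine EReal.sub_le_sub (energy_proj_ge hv fun x p hp => ?_) le_rfl
  have := h x p hp
  change inner ℝ (x : EuclideanSpace ℝ (Fin n)) p - (φ₀ x + u x) ≤ v p
  linarith

variable [IsProbabilityMeasure μ]

theorem weightedEnergy_le_weightedOptimalCost (hX : IsClosed X) (hφ₀ : IsWeight P φ₀)
    (hμ : ∀ᵐ x ∂μ, x ∈ X) : weightedEnergy P φ₀ μ ≤ weightedOptimalCost P φ₀ μ := by
  obtain ⟨C, hC⟩ := hφ₀.exists_bound hX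
  obtain ⟨x₁, hx₁⟩ := hμ.exists
  have : Nonempty X := ⟨⟨x₁, hx₁⟩⟩
  refine iSup_le fun u => le_iInf₂ fun Γ hΓ => ?_
  -- Tietze extension lets `u` be integrated against `μ` and `Γ` on the whole space.
  obtain ⟨w, -, hw⟩ :=
    BoundedContinuousFunction.exists_norm_eq_domRestrict_eq_of_closed u hX
  have huw : ∀ x : X, u x = w x := fun x => by rw [← hw]; rfl
  obtain ⟨g, hg, hgle, henergy⟩ := exists_integrable_conj (P := P)
    (φ := fun x => φ₀ x + u x) (C := C + ‖u‖) fun x p hp => by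
      linarith [hC x p hp, neg_le_of_abs_le (u.norm_coe_le_norm x)]
  have hu : ∫ x : X, u x ∂(μ.comap (Subtype.val : X → EuclideanSpace ℝ (Fin n))) =
      ∫ x, w x ∂μ := by
    simp only [huw]
    exact integral_comap_restrict hX hμ w
  obtain ⟨hi1, he1⟩ := hΓ.integral_fst (w.integrable μ)
  obtain ⟨hi2, he2⟩ := hΓ.integral_snd hg
  calc energy P (proj P fun x => φ₀ x + u x) -
        ((∫ x : X, u x ∂(μ.comap (Subtype.val : X → EuclideanSpace ℝ (Fin n))) : ℝ) : EReal)
      ≤ ((-∫ p in P, g p : ℝ) : EReal) - ((∫ x, w x ∂μ : ℝ) : EReal) := by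
        rw [hu]
        exact EReal.sub_le_sub henergy le_rfl
    _ = ((∫ z, (-g z.2 - w z.1) ∂Γ : ℝ) : EReal) := by
        rw [integral_sub (f := fun z => -g z.2) hi2.neg hi1, integral_neg, he1, he2, EReal.coe_sub]
    _ ≤ _ := by
        refine integral_le_extIntegral (hi2.neg.sub hi1) ?_
        filter_upwards [hΓ.ae_fst hμ,
          hΓ.ae_snd (ae_restrict_mem P.isCompact.isClosed.measurableSet)] with z hz1 hz2
        rw [weightedCost_of_mem φ₀ hz1, EReal.coe_le_coe_iff]
        have h1 := hgle ⟨z.1, hz1⟩ z.2 hz2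
        have h2 := huw ⟨z.1, hz1⟩
        simp only at h1 h2
        linarith

theorem weightedOptimalCost_le_weightedEnergy (hP : volume (P : Set (EuclideanSpace ℝ (Fin n))) = 1)
    (hX : IsClosed X) (hφ₀ : IsWeight P φ₀) (hμ : ∀ᵐ x ∂μ, x ∈ X) :
    weightedOptimalCost P φ₀ μ ≤ weightedEnergy P φ₀ μ := by
  obtain ⟨C, hC⟩ := hφ₀.exists_bound hX
  have hν : IsProbabilityMeasure (volume.restrict (P : Set (EuclideanSpace ℝ (Fin n)))) :=
    ⟨by simpa using hP⟩
  have hmem := ae_restrict_mem (μ := volume) P.isCompact.isClosed.measurableSet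
  obtain ⟨e, he⟩ | htop : (∃ e : ℝ, weightedEnergy P φ₀ μ = e) ∨ weightedEnergy P φ₀ μ = ⊤ := by
    induction hE : weightedEnergy P φ₀ μ with
    | bot =>
      -- The dual pair `u = 0`, `v = C` excludes `⊥`.
      have := neg_integral_le_weightedEnergy (P := P) (φ₀ := φ₀) hX hμ 0
        (v := fun _ => C) (integrable_const C) fun x p hp => by simpa using hC x p hp
      rw [hE, le_bot_iff] at this
      exact absurd this (EReal.coe_ne_bot _)
    | coe e => exact Or.inl ⟨e, rfl⟩
    | top => exact Or.inr rfl
  swap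
  · rw [htop]
    exact le_top
  -- A continuous extension of `φ₀` makes the cost continuous everywhere; its values off `X` are
  -- irrelevant, since couplings are concentrated on `X × P`.
  obtain ⟨w, hw⟩ := ContinuousMap.exists_restrict_eq hX ⟨φ₀, hφ₀.continuous⟩
  have hφw : ∀ x : X, φ₀ x = w x := fun x => (DFunLike.congr_fun hw x).symm
  let c : EuclideanSpace ℝ (Fin n) × EuclideanSpace ℝ (Fin n) → ℝ :=
    fun z => -inner ℝ z.1 z.2 + w z.1
  have hc : Continuous c := by fun_prop
  obtain ⟨Γ, -, hΓ, hle⟩ := exists_coupling_integral_le μ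
    (volume.restrict (P : Set (EuclideanSpace ℝ (Fin n))))
    (X ×ˢ (P : Set (EuclideanSpace ℝ (Fin n)))) c e (fun u v huv => by
      have h1 : ∀ x ∈ X, 0 ≤ u x + ∫ p in P, v p := fun x hx => by
        have : 0 ≤ ∫ p in P, (u x + v p) := integral_nonneg_of_ae
          (hmem.mono fun p hp => huv (x, p) ⟨hx, hp⟩)
        rwa [integral_add (integrable_const _) (v.integrable _), integral_const, probReal_univ,
          one_smul] at this
      have : 0 ≤ ∫ x, (u x + ∫ p in P, v p) ∂μ := integral_nonneg_of_ae (hμ.mono h1)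
      rwa [integral_add (u.integrable _) (integrable_const _), integral_const, probReal_univ,
          one_smul] at this) (fun u v huv => by
      have := neg_integral_le_weightedEnergy (P := P) (φ₀ := φ₀) hX hμ u (v.integrable _)
        fun x p hp => by
          have := huv (x, p) ⟨x.2, hp⟩
          simp only [c] at this
          rw [hφw x]
          linarith
      rw [he, EReal.coe_le_coe_iff] at this
      linarith)
  have := hΓ.isProbabilityMeasure
  have hΓX := hΓ.ae_fst hμ
  have hΓP := hΓ.ae_snd hmem
  have hcC : ∀ z ∈ X ×ˢ (P : Set (EuclideanSpace ℝ (Fin n))), -C ≤ c z := fun z hz => by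
    have := hC ⟨z.1, hz.1⟩ z.2 hz.2
    rw [hφw] at this
    simp only [c] at this ⊢
    linarith
  obtain ⟨hci, hce⟩ := integrable_and_integral_le_of_truncation (μ := Γ) hc.measurable (C := C)
    (e := e) (by filter_upwards [hΓX, hΓP] with z h1 h2 using hcC z ⟨h1, h2⟩) fun k => by
      -- The truncated cost is an admissible test function: it stays below `c` on `X × P` because
      -- `-C ≤ c` there.
      let f : EuclideanSpace ℝ (Fin n) × EuclideanSpace ℝ (Fin n) →ᵇ ℝ :=
        BoundedContinuousFunction.ofNormedAddCommGroup (fun z => max (-C) (min (c z) k))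
          (by fun_prop) (|C| + k) fun z => by
            rw [Real.norm_eq_abs, abs_le]
            have hk := Nat.cast_nonneg (α := ℝ) k
            exact ⟨le_max_of_le_left (by linarith [le_abs_self C]),
              max_le (by linarith [neg_abs_le C])
                ((min_le_right _ _).trans (by linarith [abs_nonneg C]))⟩
      exact hle f fun z hz => max_le (hcC z hz) (min_le_left _ _)
  rw [he]
  refine (iInf₂_le Γ hΓ).trans ((extIntegral_le_integral hci ?_).trans
    (EReal.coe_le_coe_iff.2 hce))
  filter_upwards [hΓX] with z hz
  rw [weightedCost_of_mem φ₀ hz, hφw]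

/-- Adding a constant `t` to `φ₀` makes the energy term at least `t - C`, while the linear term
costs only `t * μ.real X` with `μ.real X < 1`. -/
theorem weightedEnergy_eq_top (hP : volume (P : Set (EuclideanSpace ℝ (Fin n))) = 1)
    (hX : IsClosed X) (hφ₀ : IsWeight P φ₀) (hμ : ¬ ∀ᵐ x ∂μ, x ∈ X) :
    weightedEnergy P φ₀ μ = ⊤ := by
  obtain ⟨C, hC⟩ := hφ₀.exists_bound hX
  have hν : IsProbabilityMeasure (volume.restrict (P : Set (EuclideanSpace ℝ (Fin n)))) :=
    ⟨by simpa using hP⟩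
  have hpos : 0 < 1 - μ.real X := by
    have h := prob_compl_eq_zero_iff (μ := μ) hX.measurableSet
    rw [sub_pos]
    refine lt_of_le_of_ne measureReal_le_one fun h1 => hμ ?_
    have : μ X = 1 := by
      rw [← ENNReal.toReal_eq_one_iff]
      exact h1
    exact h.2 this
  refine EReal.eq_top_iff_forall_lt _ |>.2 fun r => ?_
  obtain ⟨t, ht⟩ : ∃ t : ℝ, r < t * (1 - μ.real X) - C :=
    ⟨(r + C + 1) / (1 - μ.real X), by rw [div_mul_cancel₀ _ hpos.ne']; linarith⟩
  refine (EReal.coe_lt_coe_iff.2 ht).trans_le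
    (le_iSup_of_le (BoundedContinuousFunction.const X t) ?_)
  have hint : ∫ x : X, BoundedContinuousFunction.const X t x
      ∂(μ.comap (Subtype.val : X → EuclideanSpace ℝ (Fin n))) = t * μ.real X := by
    refine (integral_subtype_comap hX.measurableSet fun _ => t).trans ?_
    rw [setIntegral_const, smul_eq_mul, mul_comm]
  have henergy := energy_proj_ge (P := P) (φ := fun x => φ₀ x + t) (v := fun _ => C - t)
    (integrable_const _) fun x p hp => by linarith [hC x p hp]
  rw [integral_const, probReal_univ, one_smul] at henergy
  calc ((t * (1 - μ.real X) - C : ℝ) : EReal)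
      = ((-(C - t) : ℝ) : EReal) - ((t * μ.real X : ℝ) : EReal) := by
        rw [← EReal.coe_sub]
        congr 1
        ring
    _ ≤ _ := by
        rw [hint]
        exact EReal.sub_le_sub henergy le_rfl

/-- Every coupling gives positive mass to the region where the cost is `⊤`, and the cost is at least
`-C` on the rest. Replacing `⊤` by arbitrarily large `t` avoids infinite integrals. -/
theorem weightedOptimalCost_eq_top (hX : IsClosed X) (hφ₀ : IsWeight P φ₀)
    (hμ : ¬ ∀ᵐ x ∂μ, x ∈ X) : weightedOptimalCost P φ₀ μ = ⊤ := by
  obtain ⟨C, hC⟩ := hφ₀.exists_bound hX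
  have hpos : 0 < μ.real Xᶜ := by
    rw [measureReal_def, ENNReal.toReal_pos_iff]
    exact ⟨pos_iff_ne_zero.2 hμ, measure_lt_top _ _⟩
  refine iInf₂_eq_top.2 fun Γ hΓ => EReal.eq_top_iff_forall_lt _ |>.2 fun r => ?_
  have := hΓ.isProbabilityMeasure
  obtain ⟨t, ht⟩ : ∃ t : ℝ, r < μ.real Xᶜ * t - C :=
    ⟨(r + C + 1) / μ.real Xᶜ, by rw [mul_div_cancel₀ _ hpos.ne']; linarith⟩
  obtain ⟨hi, he⟩ := hΓ.integral_fst
    ((integrable_const (μ := μ) t).indicator hX.measurableSet.compl)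
  rw [integral_indicator hX.measurableSet.compl, setIntegral_const, smul_eq_mul] at he
  refine (EReal.coe_lt_coe_iff.2 ht).trans_le ?_
  have hint : ∫ z, (Xᶜ.indicator (fun _ => t) z.1 - C) ∂Γ = μ.real Xᶜ * t - C := by
    rw [integral_sub hi (integrable_const C), he, integral_const, probReal_univ, one_smul]
  rw [← hint]
  refine integral_le_extIntegral (hi.sub (integrable_const C)) ?_
  filter_upwards [hΓ.ae_snd (ae_restrict_mem P.isCompact.isClosed.measurableSet)] with z hz
  by_cases hzX : z.1 ∈ X
  · rw [weightedCost_of_mem φ₀ hzX, EReal.coe_le_coe_iff,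
      Set.indicator_of_notMem (by simpa using hzX)]
    linarith [hC ⟨z.1, hzX⟩ z.2 hz]
  · rw [weightedCost_of_notMem φ₀ hzX]
    exact le_top

end duality

end WeightedEnergy

theorem mainTheorem9 (n : ℕ) (P : ConvexBody (EuclideanSpace ℝ (Fin n)))
    (hP : volume (P : Set (EuclideanSpace ℝ (Fin n))) = 1)
    (X : Set (EuclideanSpace ℝ (Fin n))) (hX : IsClosed X)
    (φ₀ : X → ℝ) (hφ₀ : WeightedEnergy.IsWeight P φ₀)
    (μ : Measure (EuclideanSpace ℝ (Fin n))) [IsProbabilityMeasure μ] :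
    WeightedEnergy.weightedEnergy P φ₀ μ = WeightedEnergy.weightedOptimalCost P φ₀ μ := by
  by_cases hμ : ∀ᵐ x ∂μ, x ∈ X
  · exact le_antisymm (WeightedEnergy.weightedEnergy_le_weightedOptimalCost hX hφ₀ hμ)
      (WeightedEnergy.weightedOptimalCost_le_weightedEnergy hP hX hφ₀ hμ)
  · rw [WeightedEnergy.weightedEnergy_eq_top hP hX hφ₀ hμ,
      WeightedEnergy.weightedOptimalCost_eq_top hX hφ₀ hμ]
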